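/- Let $E_{10}$ be the complex Kac–Moody algebra whose Cartan matrix $(a_{ij})$ is that of the Dynkin diagram with a chain of nine nodes $\alpha_{-1},\alpha_0,\dots,\alpha_7$ and a tenth node $\alpha_8$ attached to $\alpha_5$. Let $(\cdot|\cdot)$ be the bilinear form with $(\alpha_i|\alpha_j)=a_{ij}$ on the real dual $\mathfrak h^*$ of the Cartan subalgebra, and let $W$ be the Weyl group, generated by the simple reflections. A root is positive if it lies in $\sum_i\mathbb N\alpha_i$, real if it is $W$-conjugate to a simple root, and imaginary if $(\gamma|\gamma)\le 0$. Let $\gamma$ be a positive imaginary root of $E_{10}$. If there are $w\in W$ and positive real roots $\alpha,\beta$ with $w(\gamma)=\alpha-\beta$, then there are $w'\in W$ and positive real roots $\alpha',\beta'$ with $w'(\gamma)=\alpha'+\beta'$. -/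

import Mathlib

namespace E10

/-- The Cartan matrix of `E₁₀`, i.e. of the tree with a chain of nine nodes `0 - 1 - ⋯ - 8` and a
tenth node `9` joined to node `6`. (Node `k` carries the simple root often called `α_{k-1}`.) -/
def cartan : Matrix (Fin 10) (Fin 10) ℤ :=
  !![ 2, -1,  0,  0,  0,  0,  0,  0,  0,  0;
     -1,  2, -1,  0,  0,  0,  0,  0,  0,  0;
      0, -1,  2, -1,  0,  0,  0,  0,  0,  0;
      0,  0, -1,  2, -1,  0,  0,  0,  0,  0;
      0,  0,  0, -1,  2, -1,  0,  0,  0,  0;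
      0,  0,  0,  0, -1,  2, -1,  0,  0,  0;
      0,  0,  0,  0,  0, -1,  2, -1,  0, -1;
      0,  0,  0,  0,  0,  0, -1,  2, -1,  0;
      0,  0,  0,  0,  0,  0,  0, -1,  2,  0;
      0,  0,  0,  0,  0,  0, -1,  0,  0,  2]

/-- The Kac-Moody algebra `E₁₀` over `ℂ`, presented by Chevalley generators and Serre relations.
Since the Cartan matrix is invertible, the Cartan subalgebra is spanned by the simple coroots, so
that no further generators are needed. -/
abbrev Algebra10 : Type := Matrix.ToLieAlgebra ℂ cartan

/-- The simple coroot `αᵢ^∨`, as an element of the Lie algebra. -/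
noncomputable def corootElt (i : Fin 10) : Algebra10 :=
  LieSubmodule.Quotient.mk (N := CartanMatrix.Relations.toIdeal ℂ cartan)
    (FreeLieAlgebra.of ℂ (CartanMatrix.Generators.H i))

/-- The (real) dual `𝔥*` of the Cartan subalgebra, in coordinates: `v` stands for `∑ vᵢ αᵢ`.
The ten simple roots are a basis of `𝔥*` because the Cartan matrix is invertible. -/
abbrev DualCartan : Type := Fin 10 → ℝ

/-- The simple root `αᵢ`. -/
def simpleRoot (i : Fin 10) : DualCartan := Pi.single i 1

/-- Evaluation `v ↦ v(αᵢ^∨)` at the `i`-th simple coroot; `αⱼ(αᵢ^∨) = aᵢⱼ`. -/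
def evalCoroot (i : Fin 10) : Module.Dual ℝ DualCartan :=
  LinearMap.proj i ∘ₗ (cartan.map (Int.cast : ℤ → ℝ)).mulVecLin

/-- The invariant bilinear form on `𝔥*`, given by `(αᵢ | αⱼ) = aᵢⱼ`. -/
noncomputable def form : LinearMap.BilinForm ℝ DualCartan :=
  Matrix.toBilin' (cartan.map (Int.cast : ℤ → ℝ))

theorem evalCoroot_simpleRoot (i j : Fin 10) : evalCoroot i (simpleRoot j) = cartan i j := by
  simp [evalCoroot, simpleRoot]

theorem evalCoroot_simpleRoot_self (i : Fin 10) : evalCoroot i (simpleRoot i) = 2 := by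
  rw [evalCoroot_simpleRoot]
  have h : cartan i i = 2 := by revert i; decide
  rw [h]
  norm_num

/-- The simple reflection `rᵢ(v) = v - v(αᵢ^∨) αᵢ`. -/
def simpleReflection (i : Fin 10) : DualCartan ≃ₗ[ℝ] DualCartan :=
  Module.reflection (evalCoroot_simpleRoot_self i)

/-- The Weyl group, generated by the simple reflections. -/
def weylGroup : Subgroup (DualCartan ≃ₗ[ℝ] DualCartan) :=
  Subgroup.closure (Set.range simpleReflection)

/-- The space of all `x` in the Lie algebra with `[h, x] = v(h) x` for all `h` in the Cartan
subalgebra (equivalently, for all simple coroots `h`). -/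
noncomputable def rootSpace (v : DualCartan) : Submodule ℂ Algebra10 :=
  ⨅ i : Fin 10, Module.End.eigenspace (LieAlgebra.ad ℂ Algebra10 (corootElt i))
    ((evalCoroot i v : ℝ) : ℂ)

/-- `v` is a root of `E₁₀`. -/
def IsRoot (v : DualCartan) : Prop := v ≠ 0 ∧ rootSpace v ≠ ⊥

/-- `v` is a positive root: a root that lies in `∑ ℕ αᵢ`. -/
def IsPosRoot (v : DualCartan) : Prop :=
  IsRoot v ∧ ∃ k : Fin 10 → ℕ, v = ∑ i, k i • simpleRoot i

/-- `v` is a real root: a root that some Weyl group element maps to a simple root. -/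
def IsRealRoot (v : DualCartan) : Prop :=
  IsRoot v ∧ ∃ w ∈ weylGroup, ∃ i, w v = simpleRoot i

/-- `v` is an imaginary root: a root with `(v | v) ≤ 0`. -/
def IsImagRoot (v : DualCartan) : Prop := IsRoot v ∧ form v v ≤ 0

/-- `v` is a positive real root. -/
def IsPosRealRoot (v : DualCartan) : Prop := IsRealRoot v ∧ IsPosRoot v

/-- `v` is a positive imaginary root. -/
def IsPosImagRoot (v : DualCartan) : Prop := IsImagRoot v ∧ IsPosRoot v

end E10

/-! Let `s` be the reflection in `β`. From `w γ = α - β` follows `s w γ = s α + β`. If `s α` is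
positive, this is the required sum. Otherwise `s α = -λ` with `λ` a positive real root, and `s w γ =
β - λ` is again a difference. The Weyl group keeps `γ` in the positive cone, so `β - λ` is nonzero
with nonnegative coordinates and `λ` has smaller height than `β`. Descent on that height ends
(`exists_sum_of_sub`).

Three facts support this. Reflections carry integral roots to roots, by sl₂ theory
(`IsRoot.simpleReflection`). Real roots are positive or negative
(`nonneg_or_nonpos_of_form_eq_two`), and nonzero nonnegative integral vectors of norm at most 0 stay
nonnegative under reflections (`ImagCone.simpleReflection`). The last two follow from the form being
positive semidefinite once a node is deleted, and definite unless that node is `0`, where affine E₈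
remains. -/

namespace E10

/-! ### Strings of sl₂-weights -/

section Sl2

variable {K L : Type*} [Field K] [LieRing L] [LieAlgebra K L]

theorem lie_ad_pow_of_eigen {h y x : L} {c d : K} (hy : ⁅h, y⁆ = c • y) (hx : ⁅h, x⁆ = d • x)
    (n : ℕ) :
    ⁅h, (LieAlgebra.ad K L y ^ n) x⁆ = (d + n * c) • (LieAlgebra.ad K L y ^ n) x := by
  induction n with
  | zero => simpa using hx
  | succ n ih =>
    rw [pow_succ', Module.End.mul_apply, LieAlgebra.ad_apply, leibniz_lie, hy, ih, smul_lie,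
      lie_smul, ← add_smul]
    congr 1
    push_cast
    ring

theorem lie_ad_pow_succ {h e f x : L} {μ : K} (hef : ⁅e, f⁆ = h) (hf : ⁅h, f⁆ = (-2 : K) • f)
    (hx : ⁅h, x⁆ = μ • x) (n : ℕ) :
    ⁅e, (LieAlgebra.ad K L f ^ (n + 1)) x⁆ = (LieAlgebra.ad K L f ^ (n + 1)) ⁅e, x⁆ +
      ((n + 1) * (μ - n)) • (LieAlgebra.ad K L f ^ n) x := by
  induction n with
  | zero => simp [leibniz_lie e f x, hef, hx, add_comm]
  | succ n ih =>
    have hs (m : ℕ) (y : L) : (LieAlgebra.ad K L f ^ (m + 1)) y =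
        ⁅f, (LieAlgebra.ad K L f ^ m) y⁆ := by
      rw [pow_succ', Module.End.mul_apply, LieAlgebra.ad_apply]
    rw [hs (n + 1) x, leibniz_lie, hef, lie_ad_pow_of_eigen hf hx, ih, lie_add, lie_smul,
      ← hs n x, ← hs (n + 1), add_left_comm, ← add_smul]
    congr 2
    push_cast
    ring

/-- Induction on `k` applied to `⁅e, x⁆`, of weight `n + 2`, shows that `x` is a highest weight
vector. Then `e` leads from `f ^ (m + 1) x` back to `f ^ m x` with factor `(m + 1) * (n - m)`,
nonzero for `m < n`. -/
theorem eq_zero_of_ad_pow_eq_zero [CharZero K] {h e f : L} (hef : ⁅e, f⁆ = h)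
    (he : ⁅h, e⁆ = (2 : K) • e) (hf : ⁅h, f⁆ = (-2 : K) • f) (k : ℕ) :
    ∀ (n : ℕ) (x : L), (LieAlgebra.ad K L e ^ k) x = 0 → ⁅h, x⁆ = (n : K) • x →
      (LieAlgebra.ad K L f ^ n) x = 0 → x = 0 := by
  induction k with
  | zero => intro n x h0 _ _; simpa using h0
  | succ k ih =>
    intro n x hk hx hn
    have hex : ⁅e, x⁆ = 0 := by
      refine ih (n + 2) _ (by simpa [pow_succ] using hk) ?_ ?_
      · rw [leibniz_lie, he, hx, smul_lie, lie_smul, ← add_smul]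
        congr 1
        push_cast
        ring
      · have h1 := lie_ad_pow_succ hef hf hx (n + 1)
        have h2 : (LieAlgebra.ad K L f ^ (n + 1)) x = 0 := by
          rw [pow_succ', Module.End.mul_apply, hn, map_zero]
        have h3 : (LieAlgebra.ad K L f ^ (n + 1 + 1)) x = 0 := by
          rw [pow_succ', Module.End.mul_apply, h2, map_zero]
        rw [h2, h3, lie_zero, smul_zero, add_zero] at h1
        exact h1.symm
    have key : ∀ m : ℕ, m ≤ n → (LieAlgebra.ad K L f ^ m) x = 0 → x = 0 := by
      intro m
      induction m with
      | zero => intro _ h0; simpa using h0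
      | succ m ihm =>
        intro hm h0
        refine ihm (by omega) ?_
        have h1 := lie_ad_pow_succ hef hf hx m
        rw [h0, hex, lie_zero, map_zero, zero_add] at h1
        refine (smul_eq_zero.1 h1.symm).resolve_left (mul_ne_zero ?_ ?_)
        · exact_mod_cast Nat.succ_ne_zero m
        · rw [sub_ne_zero]
          exact_mod_cast (by omega : n ≠ m)
    exact key n le_rfl hn

end Sl2

/-! ### Chevalley generators and local nilpotency -/

open CartanMatrix

/-- The quotient map from the free Lie algebra. -/
noncomputable def ofFree : FreeLieAlgebra ℂ (Generators (Fin 10)) →ₗ⁅ℂ⁆ Algebra10 :=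
  { (LieSubmodule.Quotient.mk' (Relations.toIdeal ℂ cartan)).toLinearMap with
    map_lie' := fun {x y} => LieSubmodule.Quotient.mk_bracket (I := Relations.toIdeal ℂ cartan) x y }

theorem ofFree_surjective : Function.Surjective ofFree :=
  LieSubmodule.Quotient.surjective_mk' (Relations.toIdeal ℂ cartan)

/-- The image of a generator in the Kac-Moody algebra. -/
noncomputable def gen (g : Generators (Fin 10)) : Algebra10 := ofFree (FreeLieAlgebra.of ℂ g)

theorem ofFree_of (g : Generators (Fin 10)) : ofFree (FreeLieAlgebra.of ℂ g) = gen g := rfl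

theorem ofFree_ad_pow (x y : FreeLieAlgebra ℂ (Generators (Fin 10))) (n : ℕ) :
    ofFree ((LieAlgebra.ad ℂ _ x ^ n) y) =
      (LieAlgebra.ad ℂ Algebra10 (ofFree x) ^ n) (ofFree y) := by
  induction n with
  | zero => rfl
  | succ n ih =>
    rw [pow_succ', pow_succ', Module.End.mul_apply, Module.End.mul_apply, LieAlgebra.ad_apply,
      LieHom.map_lie, ih, LieAlgebra.ad_apply]

theorem ofFree_eq_zero {r : FreeLieAlgebra ℂ (Generators (Fin 10))}
    (hr : r ∈ Relations.toSet ℂ cartan) : ofFree r = 0 :=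
  (LieSubmodule.Quotient.mk_eq_zero' (N := Relations.toIdeal ℂ cartan)).2
    (LieSubmodule.subset_lieSpan hr)

theorem lie_E_F_self (i : Fin 10) : ⁅gen (.E i), gen (.F i)⁆ = gen (.H i) := by
  have := ofFree_eq_zero (r := Relations.EF ℂ (i, i)) (by simp [Relations.toSet])
  simp only [Relations.EF, Function.uncurry, if_true, Function.comp] at this
  rwa [map_sub, LieHom.map_lie, sub_eq_zero] at this

theorem lie_E_F_of_ne {i j : Fin 10} (h : i ≠ j) : ⁅gen (.E i), gen (.F j)⁆ = 0 := by
  have := ofFree_eq_zero (r := Relations.EF ℂ (i, j)) (by simp [Relations.toSet])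
  simp only [Relations.EF, Function.uncurry, if_neg h, Function.comp] at this
  rwa [LieHom.map_lie] at this

theorem lie_H_E (i j : Fin 10) : ⁅gen (.H i), gen (.E j)⁆ = (cartan i j : ℂ) • gen (.E j) := by
  have := ofFree_eq_zero (r := Relations.HE ℂ cartan (i, j)) (by simp [Relations.toSet])
  simp only [Relations.HE, Function.uncurry, Function.comp] at this
  rwa [map_sub, LieHom.map_lie, map_zsmul, sub_eq_zero, ← Int.cast_smul_eq_zsmul ℂ] at this

theorem lie_H_F (i j : Fin 10) : ⁅gen (.H i), gen (.F j)⁆ = (-cartan i j : ℂ) • gen (.F j) := by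
  have := ofFree_eq_zero (r := Relations.HF ℂ cartan (i, j)) (by simp [Relations.toSet])
  simp only [Relations.HF, Function.uncurry, Function.comp] at this
  rwa [map_add, LieHom.map_lie, map_zsmul, add_eq_zero_iff_eq_neg,
    ← Int.cast_smul_eq_zsmul ℂ, ← neg_smul] at this

theorem ad_E_pow_E (i j : Fin 10) :
    (LieAlgebra.ad ℂ Algebra10 (gen (.E i)) ^ ((-cartan i j).toNat + 1)) (gen (.E j)) = 0 := by
  have := ofFree_eq_zero (r := Relations.adE ℂ cartan (i, j)) (by simp [Relations.toSet])
  simp only [Relations.adE, Function.uncurry, Function.comp] at this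
  rw [ofFree_ad_pow, LieHom.map_lie] at this
  rw [pow_succ]
  exact this

theorem ad_F_pow_F (i j : Fin 10) :
    (LieAlgebra.ad ℂ Algebra10 (gen (.F i)) ^ ((-cartan i j).toNat + 1)) (gen (.F j)) = 0 := by
  have := ofFree_eq_zero (r := Relations.adF ℂ cartan (i, j)) (by simp [Relations.toSet])
  simp only [Relations.adF, Function.uncurry, Function.comp] at this
  rw [ofFree_ad_pow, LieHom.map_lie] at this
  rw [pow_succ]
  exact this

theorem eq_top_of_gen_mem (S : LieSubalgebra ℂ Algebra10) (hS : ∀ g, gen g ∈ S) : S = ⊤ := by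
  let φ : FreeLieAlgebra ℂ (Generators (Fin 10)) →ₗ⁅ℂ⁆ S :=
    FreeLieAlgebra.lift ℂ fun g => ⟨gen g, hS g⟩
  have hφ : S.incl.comp φ = ofFree := FreeLieAlgebra.hom_ext fun g => by simp [φ, ofFree_of]
  refine eq_top_iff.2 fun x _ => ?_
  obtain ⟨y, rfl⟩ := ofFree_surjective x
  rw [← hφ]
  exact (φ y).2

/-- The vectors killed by a power of `ad E` form the Engel subalgebra, so generators suffice. -/
theorem ad_E_locally_nilpotent (i : Fin 10) (x : Algebra10) :
    ∃ n : ℕ, (LieAlgebra.ad ℂ Algebra10 (gen (.E i)) ^ n) x = 0 := by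
  rw [← LieSubalgebra.mem_engel_iff, eq_top_of_gen_mem (LieSubalgebra.engel ℂ (gen (.E i)))]
  · trivial
  have hH (j : Fin 10) :
      (LieAlgebra.ad ℂ Algebra10 (gen (.E i)) ^ 2) (gen (.H j)) = 0 := by
    rw [pow_two, Module.End.mul_apply, LieAlgebra.ad_apply, LieAlgebra.ad_apply,
      ← lie_skew (gen (.E i)) (gen (.H j)), lie_H_E, lie_neg, lie_smul, lie_self, smul_zero, neg_zero]
  rintro (j | j | j) <;> rw [LieSubalgebra.mem_engel_iff]
  · exact ⟨2, hH j⟩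
  · exact ⟨_, ad_E_pow_E i j⟩
  · refine ⟨3, ?_⟩
    rw [pow_succ, Module.End.mul_apply, LieAlgebra.ad_apply]
    rcases eq_or_ne i j with rfl | h
    · rw [lie_E_F_self, hH]
    · rw [lie_E_F_of_ne h, map_zero]

theorem ad_F_locally_nilpotent (i : Fin 10) (x : Algebra10) :
    ∃ n : ℕ, (LieAlgebra.ad ℂ Algebra10 (gen (.F i)) ^ n) x = 0 := by
  rw [← LieSubalgebra.mem_engel_iff, eq_top_of_gen_mem (LieSubalgebra.engel ℂ (gen (.F i)))]
  · trivial
  have hH (j : Fin 10) :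
      (LieAlgebra.ad ℂ Algebra10 (gen (.F i)) ^ 2) (gen (.H j)) = 0 := by
    rw [pow_two, Module.End.mul_apply, LieAlgebra.ad_apply, LieAlgebra.ad_apply,
      ← lie_skew (gen (.F i)) (gen (.H j)), lie_H_F, lie_neg, lie_smul, lie_self, smul_zero, neg_zero]
  rintro (j | j | j) <;> rw [LieSubalgebra.mem_engel_iff]
  · exact ⟨2, hH j⟩
  · refine ⟨3, ?_⟩
    rw [pow_succ, Module.End.mul_apply, LieAlgebra.ad_apply, ← lie_skew]
    rcases eq_or_ne j i with rfl | h
    · rw [lie_E_F_self, map_neg, hH, neg_zero]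
    · rw [lie_E_F_of_ne h, neg_zero, map_zero]
  · exact ⟨_, ad_F_pow_F i j⟩

/-! ### Reflections permute integral roots -/

theorem mem_rootSpace {v : DualCartan} {x : Algebra10} :
    x ∈ rootSpace v ↔ ∀ i, ⁅gen (.H i), x⁆ = ((evalCoroot i v : ℝ) : ℂ) • x := by
  simp only [rootSpace, Submodule.mem_iInf, Module.End.mem_eigenspace_iff]
  rfl

theorem simpleReflection_apply (i : Fin 10) (v : DualCartan) :
    simpleReflection i v = v - evalCoroot i v • simpleRoot i :=
  Module.reflection_apply _ _

theorem cartan_self (i : Fin 10) : cartan i i = 2 := by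
  revert i; decide

theorem IsRoot.simpleReflection {v : DualCartan} (hv : IsRoot v) (i : Fin 10) (z : ℤ)
    (hz : evalCoroot i v = z) : IsRoot (simpleReflection i v) := by
  obtain ⟨hv0, hv⟩ := hv
  refine ⟨by simpa using hv0, ?_⟩
  obtain ⟨x, hx, hx0⟩ := Submodule.exists_mem_ne_zero_of_ne_bot hv
  rw [mem_rootSpace] at hx
  have hxi := hx i
  have he : ⁅gen (.H i), gen (.E i)⁆ = (2 : ℂ) • gen (.E i) := by simp [lie_H_E, cartan_self]
  have hf : ⁅gen (.H i), gen (.F i)⁆ = (-2 : ℂ) • gen (.F i) := by simp [lie_H_F, cartan_self]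
  obtain ⟨n, rfl | rfl⟩ := z.eq_nat_or_neg
  · obtain ⟨k, hk⟩ := ad_E_locally_nilpotent i x
    refine (Submodule.ne_bot_iff _).2 ⟨(LieAlgebra.ad ℂ Algebra10 (gen (.F i)) ^ n) x, ?_, ?_⟩
    · refine mem_rootSpace.2 fun j => ?_
      rw [lie_ad_pow_of_eigen (lie_H_F j i) (hx j), simpleReflection_apply, map_sub, map_smul,
        evalCoroot_simpleRoot, hz]
      congr 1
      push_cast [smul_eq_mul]
      ring
    · refine fun h0 => hx0 (eq_zero_of_ad_pow_eq_zero (lie_E_F_self i) he hf k n x hk ?_ h0)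
      simpa [hz] using hxi
  · obtain ⟨k, hk⟩ := ad_F_locally_nilpotent i x
    refine (Submodule.ne_bot_iff _).2 ⟨(LieAlgebra.ad ℂ Algebra10 (gen (.E i)) ^ n) x, ?_, ?_⟩
    · refine mem_rootSpace.2 fun j => ?_
      rw [lie_ad_pow_of_eigen (lie_H_E j i) (hx j), simpleReflection_apply, map_sub, map_smul,
        evalCoroot_simpleRoot, hz]
      congr 1
      push_cast [smul_eq_mul]
      ring
    -- For a negative weight, `(-h, f, e)` serves as the sl₂-triple.
    · refine fun h0 => hx0 (eq_zero_of_ad_pow_eq_zero (h := -gen (.H i)) (e := gen (.F i))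
        (f := gen (.E i)) (K := ℂ) ?_ ?_ ?_ k n x hk ?_ h0)
      · rw [← lie_skew, lie_E_F_self]
      · rw [neg_lie, hf, neg_smul, neg_neg]
      · rw [neg_lie, he, neg_smul]
      · rw [neg_lie, hxi, hz]
        simp

/-! ### The form and integral vectors -/

theorem form_apply (v w : DualCartan) : form v w = ∑ i, ∑ j, v i * (cartan i j : ℝ) * w j := by
  simp [form, Matrix.toBilin'_apply]

theorem cartan_symm (i j : Fin 10) : cartan i j = cartan j i :=
  have h : cartan.IsSymm := by decide
  h.apply j i

theorem cartan_nonpos {i j : Fin 10} (h : i ≠ j) : cartan i j ≤ 0 := by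
  fin_cases i <;> fin_cases j <;> first | exact absurd rfl h | decide

theorem form_comm (v w : DualCartan) : form v w = form w v := by
  rw [form_apply, form_apply, Finset.sum_comm]
  refine Finset.sum_congr rfl fun i _ => Finset.sum_congr rfl fun j _ => ?_
  rw [cartan_symm]
  ring

theorem form_simpleRoot_left (i : Fin 10) (v : DualCartan) :
    form (simpleRoot i) v = evalCoroot i v := by
  simp [form_apply, evalCoroot, simpleRoot, Pi.single_apply, Matrix.mulVec, dotProduct]

theorem form_simpleRoot_self (i : Fin 10) : form (simpleRoot i) (simpleRoot i) = 2 := by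
  rw [form_simpleRoot_left, evalCoroot_simpleRoot_self]

theorem form_simpleReflection (i : Fin 10) (v : DualCartan) :
    form (simpleReflection i v) (simpleReflection i v) = form v v := by
  rw [simpleReflection_apply, ← form_simpleRoot_left]
  simp only [map_sub, map_smul, LinearMap.sub_apply, LinearMap.smul_apply, smul_eq_mul,
    form_simpleRoot_self, form_comm v (simpleRoot i)]
  ring

theorem simpleReflection_simpleRoot (i : Fin 10) :
    simpleReflection i (simpleRoot i) = -simpleRoot i := by
  rw [simpleReflection_apply, evalCoroot_simpleRoot_self, two_smul]
  abel

/-- The vector with the given integral coordinates. -/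
def ofInt (k : Fin 10 → ℤ) : DualCartan := fun i => k i

theorem ofInt_sub (k l : Fin 10 → ℤ) : ofInt (k - l) = ofInt k - ofInt l := by
  ext i; simp [ofInt]

theorem ofInt_neg (k : Fin 10 → ℤ) : ofInt (-k) = -ofInt k := by
  ext i; simp [ofInt]

theorem ofInt_injective : Function.Injective ofInt := fun k l h => by
  ext i
  exact Int.cast_injective (α := ℝ) (congrFun h i)

theorem simpleRoot_eq_ofInt (i : Fin 10) : simpleRoot i = ofInt (Pi.single i 1) := by
  ext j
  rcases eq_or_ne j i with rfl | h <;> simp [simpleRoot, ofInt, *]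

theorem evalCoroot_ofInt (i : Fin 10) (k : Fin 10 → ℤ) :
    evalCoroot i (ofInt k) = (cartan.mulVec k i : ℤ) := by
  simp [evalCoroot, ofInt, Matrix.mulVec, dotProduct]

theorem simpleReflection_ofInt (i : Fin 10) (k : Fin 10 → ℤ) :
    simpleReflection i (ofInt k) = ofInt (k - Pi.single i (cartan.mulVec k i)) := by
  rw [simpleReflection_apply, evalCoroot_ofInt]
  ext j
  rcases eq_or_ne j i with rfl | h <;> simp [simpleRoot, ofInt, *]

theorem exists_form_ofInt (k : Fin 10 → ℤ) : ∃ n : ℤ, form (ofInt k) (ofInt k) = 2 * n := by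
  refine ⟨∑ i, k i ^ 2 - (k 0 * k 1 + k 1 * k 2 + k 2 * k 3 + k 3 * k 4 + k 4 * k 5 + k 5 * k 6 +
    k 6 * k 7 + k 7 * k 8 + k 6 * k 9), ?_⟩
  simp [form_apply, Fin.sum_univ_succ, cartan, ofInt]
  ring

theorem two_le_form_of_pos {k : Fin 10 → ℤ} (h : 0 < form (ofInt k) (ofInt k)) :
    2 ≤ form (ofInt k) (ofInt k) := by
  obtain ⟨n, hn⟩ := exists_form_ofInt k
  rw [hn] at h ⊢
  have : (0 : ℝ) < n := by linarith
  have : (1 : ℝ) ≤ n := by exact_mod_cast (by exact_mod_cast this : 0 < n)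
  linarith

/-! ### Positivity of the form after deleting a node -/

/-- Where `d` is positive, the difference of the sides is a sum of terms `-aᵢⱼ dᵢ dⱼ (vᵢ/dᵢ -
vⱼ/dⱼ)² / 2` over `i ≠ j`, and off-diagonal entries are nonpositive. -/
theorem sum_le_form (d : Fin 10 → ℝ) (hd : ∀ i, 0 ≤ d i) (v : DualCartan)
    (hv : ∀ i, d i = 0 → v i = 0) :
    ∑ i, v i ^ 2 / d i * ∑ j, (cartan i j : ℝ) * d j ≤ form v v := by
  have h1 : ∑ i, v i ^ 2 / d i * ∑ j, (cartan i j : ℝ) * d j =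
      ∑ i, ∑ j, (cartan i j : ℝ) * (v i ^ 2 / d i * d j + v j ^ 2 / d j * d i) / 2 := by
    have h2 : ∑ i, v i ^ 2 / d i * ∑ j, (cartan i j : ℝ) * d j =
        ∑ i, ∑ j, (cartan i j : ℝ) * (v i ^ 2 / d i * d j) := by
      refine Finset.sum_congr rfl fun i _ => ?_
      rw [Finset.mul_sum]
      exact Finset.sum_congr rfl fun j _ => by ring
    have h3 : ∑ i, ∑ j, (cartan i j : ℝ) * (v j ^ 2 / d j * d i) =
        ∑ i, ∑ j, (cartan i j : ℝ) * (v i ^ 2 / d i * d j) := by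
      rw [Finset.sum_comm]
      exact Finset.sum_congr rfl fun i _ => Finset.sum_congr rfl fun j _ => by rw [cartan_symm]
    simp only [mul_add, add_div, Finset.sum_add_distrib, ← Finset.sum_div]
    rw [h3, h2]
    ring
  rw [h1, form_apply]
  refine Finset.sum_le_sum fun i _ => Finset.sum_le_sum fun j _ => ?_
  rcases (hd i).eq_or_lt with hi | hi
  · simp [← hi, hv i hi.symm]
  rcases (hd j).eq_or_lt with hj | hj
  · simp [← hj, hv j hj.symm]
  rcases eq_or_ne i j with rfl | h
  · refine le_of_eq ?_
    field_simp
    ring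
  · have h4 : v i ^ 2 / d i * d j + v j ^ 2 / d j * d i - 2 * (v i * v j) =
        d i * d j * (v i / d i - v j / d j) ^ 2 := by
      field_simp
      ring
    have h5 : 0 ≤ d i * d j * (v i / d i - v j / d j) ^ 2 := by positivity
    have h6 : (cartan i j : ℝ) ≤ 0 := by exact_mod_cast cartan_nonpos h
    nlinarith

/-- Row `j` vanishes at node `j`, is positive at all other nodes, and its product with the Cartan
matrix is nonnegative (positive, if `j ≠ 0`) at all nodes other than `j`. -/
def weight : Fin 10 → Fin 10 → ℤ :=
  ![![0, 1, 2, 3, 4, 5, 6, 4, 2, 3],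
    ![1, 0, 58, 114, 168, 220, 270, 182, 92, 136],
    ![2, 2, 0, 27, 52, 75, 96, 66, 34, 49],
    ![3, 4, 3, 0, 16, 30, 42, 30, 16, 22],
    ![2, 3, 3, 2, 0, 5, 9, 7, 4, 5],
    ![5, 8, 9, 8, 5, 0, 6, 6, 4, 4],
    ![6, 10, 12, 12, 10, 6, 0, 2, 2, 1],
    ![8, 14, 18, 20, 20, 18, 14, 0, 1, 8],
    ![8, 15, 21, 26, 30, 33, 35, 18, 0, 18],
    ![9, 16, 21, 24, 25, 24, 21, 16, 9, 0]]

theorem weight_nonneg (j i : Fin 10) : 0 ≤ weight j i := by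
  revert j i; decide

theorem eq_of_weight_eq_zero {j i : Fin 10} (h : weight j i = 0) : i = j := by
  revert j i; decide

theorem sum_cartan_weight_nonneg {j i : Fin 10} (h : i ≠ j) :
    0 ≤ ∑ l, cartan i l * weight j l := by
  revert j i; decide

theorem sum_cartan_weight_pos {j i : Fin 10} (hj : j ≠ 0) (h : i ≠ j) :
    0 < ∑ l, cartan i l * weight j l := by
  revert j i; decide

theorem sum_weight_le_form {v : DualCartan} {j : Fin 10} (hv : v j = 0) :
    ∑ i, v i ^ 2 / (weight j i : ℝ) * ((∑ l, cartan i l * weight j l : ℤ) : ℝ) ≤ form v v := by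
  have := sum_le_form (fun i => (weight j i : ℝ)) (fun i => by exact_mod_cast weight_nonneg j i) v
    fun i hi => by
      have h0 : weight j i = 0 := by exact_mod_cast hi
      rw [eq_of_weight_eq_zero h0, hv]
  push_cast
  exact this

theorem weight_term_nonneg {v : DualCartan} {j : Fin 10} (hv : v j = 0) (i : Fin 10) :
    0 ≤ v i ^ 2 / (weight j i : ℝ) * ((∑ l, cartan i l * weight j l : ℤ) : ℝ) := by
  rcases eq_or_ne i j with rfl | h
  · simp [hv]
  · have h1 : (0 : ℝ) ≤ weight j i := by exact_mod_cast weight_nonneg j i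
    have h2 : (0 : ℝ) ≤ (∑ l, cartan i l * weight j l : ℤ) := by
      exact_mod_cast sum_cartan_weight_nonneg h
    positivity

theorem form_self_nonneg {v : DualCartan} {j : Fin 10} (hv : v j = 0) : 0 ≤ form v v :=
  (Finset.sum_nonneg fun i _ => weight_term_nonneg hv i).trans (sum_weight_le_form hv)

theorem form_self_pos {v : DualCartan} {j i : Fin 10} (hj : j ≠ 0) (hv : v j = 0) (hi : v i ≠ 0) :
    0 < form v v := by
  refine (Finset.sum_pos' (fun i _ => weight_term_nonneg hv i) ⟨i, Finset.mem_univ i, ?_⟩).trans_le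
    (sum_weight_le_form hv)
  have hij : i ≠ j := fun h => hi (h ▸ hv)
  have h1 : (0 : ℝ) < weight j i := by
    exact_mod_cast (weight_nonneg j i).lt_of_ne fun h => hij (eq_of_weight_eq_zero h.symm)
  have h2 : (0 : ℝ) < (∑ l, cartan i l * weight j l : ℤ) := by
    exact_mod_cast sum_cartan_weight_pos hj hij
  positivity

/-! ### Signs of coordinates of short vectors -/

/-- The positive part of an integral vector. -/
def posPart (k : Fin 10 → ℤ) : Fin 10 → ℤ := fun i => max (k i) 0

theorem posPart_term_nonpos (k : Fin 10 → ℤ) (i j : Fin 10) :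
    ofInt (posPart k) i * (cartan i j : ℝ) * ofInt (posPart (-k)) j ≤ 0 := by
  rcases eq_or_ne i j with rfl | h
  · rcases le_total (k i) 0 with h | h <;> simp [ofInt, posPart, h]
  · have h1 : (0 : ℝ) ≤ ofInt (posPart k) i := by simp [ofInt, posPart]
    have h2 : (0 : ℝ) ≤ ofInt (posPart (-k)) j := by simp [ofInt, posPart]
    have h3 : (cartan i j : ℝ) ≤ 0 := by exact_mod_cast cartan_nonpos h
    exact mul_nonpos_of_nonpos_of_nonneg (mul_nonpos_of_nonneg_of_nonpos h1 h3) h2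

theorem form_posPart_nonpos (k : Fin 10 → ℤ) :
    form (ofInt (posPart k)) (ofInt (posPart (-k))) ≤ 0 := by
  rw [form_apply]
  exact Finset.sum_nonpos fun i _ => Finset.sum_nonpos fun j _ => posPart_term_nonpos k i j

theorem form_posPart_neg {k : Fin 10 → ℤ} {i j : Fin 10} (hi : 0 < k i) (hj : k j < 0)
    (hij : cartan i j < 0) : form (ofInt (posPart k)) (ofInt (posPart (-k))) < 0 := by
  rw [form_apply]
  refine Finset.sum_neg' (fun i _ => Finset.sum_nonpos fun j _ => posPart_term_nonpos k i j)
    ⟨i, Finset.mem_univ i, ?_⟩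
  refine Finset.sum_neg' (fun j _ => posPart_term_nonpos k i j) ⟨j, Finset.mem_univ j, ?_⟩
  have h1 : (0 : ℝ) < ofInt (posPart k) i := by simp [ofInt, posPart, hi]
  have h2 : (0 : ℝ) < ofInt (posPart (-k)) j := by simp [ofInt, posPart, hj]
  have h3 : (cartan i j : ℝ) < 0 := by exact_mod_cast hij
  exact mul_neg_of_neg_of_pos (mul_neg_of_pos_of_neg h1 h3) h2

theorem form_ofInt_eq (k : Fin 10 → ℤ) :
    form (ofInt k) (ofInt k) = form (ofInt (posPart k)) (ofInt (posPart k)) +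
      form (ofInt (posPart (-k))) (ofInt (posPart (-k))) -
      2 * form (ofInt (posPart k)) (ofInt (posPart (-k))) := by
  have h : k = posPart k - posPart (-k) := by
    ext i
    simp only [posPart, Pi.sub_apply, Pi.neg_apply]
    omega
  conv_lhs => rw [h, ofInt_sub]
  simp only [map_sub, LinearMap.sub_apply, form_comm (ofInt (posPart (-k))) (ofInt (posPart k))]
  ring

/-- Write `k = p - q` with disjoint supports, so `(p|q) ≤ 0`. As `p` vanishes at `a ≠ 0`, its norm
is at least 2. The same holds for `q` if it vanishes at a node other than `0`. If `k 1 < 0 < k 0`,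
the edge from `0` to `1` makes `(p|q)` negative instead. -/
theorem two_lt_form_of_mixed {k : Fin 10 → ℤ} (h0 : 0 ≤ k 0) {a b : Fin 10} (ha : k a < 0)
    (hb : 0 < k b) : 2 < form (ofInt k) (ofInt k) := by
  have ha0 : a ≠ 0 := by rintro rfl; omega
  have hp : 2 ≤ form (ofInt (posPart k)) (ofInt (posPart k)) :=
    two_le_form_of_pos <| form_self_pos (i := b) ha0 (by simp [ofInt, posPart, ha.le])
      (by simp [ofInt, posPart, hb])
  have hq : ∀ j, j ≠ 0 → 0 ≤ k j → 2 ≤ form (ofInt (posPart (-k))) (ofInt (posPart (-k))) :=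
    fun j hj hkj => two_le_form_of_pos <| form_self_pos (i := a) hj (by simp [ofInt, posPart, hkj])
      (by simp [ofInt, posPart, ha])
  have hpq := form_posPart_nonpos k
  rw [form_ofInt_eq]
  rcases lt_or_ge (k 1) 0 with h1 | h1
  · rcases h0.eq_or_lt with h0 | h0
    · have := hq b (by rintro rfl; omega) hb.le
      linarith
    · have h2 : 0 ≤ form (ofInt (posPart (-k))) (ofInt (posPart (-k))) :=
        form_self_nonneg (j := 0) (by simp [ofInt, posPart, h0.le])
      have h3 := form_posPart_neg h0 h1 (by decide)
      linarith
  · have := hq 1 (by decide) h1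
    linarith

theorem nonneg_or_nonpos_of_form_eq_two {k : Fin 10 → ℤ} (hk : form (ofInt k) (ofInt k) = 2) :
    (∀ i, 0 ≤ k i) ∨ ∀ i, k i ≤ 0 := by
  by_contra! h
  obtain ⟨⟨a, ha⟩, b, hb⟩ := h
  rcases le_total 0 (k 0) with h0 | h0
  · exact (two_lt_form_of_mixed h0 ha hb).ne' hk
  · refine (two_lt_form_of_mixed (k := -k) (a := b) (b := a) ?_ ?_ ?_).ne' ?_
    · simpa using h0
    · simpa using hb
    · simpa using ha
    · simpa [ofInt_neg] using hk

theorem form_pos_of_one_neg {k : Fin 10 → ℤ} {i : Fin 10} (hi : k i < 0)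
    (h : ∀ j, j ≠ i → 0 ≤ k j) : 0 < form (ofInt k) (ofInt k) := by
  -- The negative part is supported at `i` alone; strict positivity needs a vanishing node other
  -- than `0`.
  obtain ⟨j, hj0, hji⟩ : ∃ j : Fin 10, j ≠ 0 ∧ j ≠ i := by
    clear hi h
    revert i; decide
  have hp : 0 ≤ form (ofInt (posPart k)) (ofInt (posPart k)) :=
    form_self_nonneg (j := i) (by simp [ofInt, posPart, hi.le])
  have hq : 0 < form (ofInt (posPart (-k))) (ofInt (posPart (-k))) :=
    form_self_pos (i := i) hj0 (by simp [ofInt, posPart, h j hji]) (by simp [ofInt, posPart, hi])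
  have hpq := form_posPart_nonpos k
  rw [form_ofInt_eq]
  linarith

/-! ### Weyl group action on the cone and on real roots -/

/-- The nonzero vectors of nonpositive norm in the monoid spanned by the simple roots. -/
def ImagCone (v : DualCartan) : Prop :=
  (∃ k : Fin 10 → ℤ, (∀ i, 0 ≤ k i) ∧ v = ofInt k) ∧ v ≠ 0 ∧ form v v ≤ 0

theorem ImagCone.simpleReflection {v : DualCartan} (hv : ImagCone v) (i : Fin 10) :
    ImagCone (simpleReflection i v) := by
  obtain ⟨⟨k, hk, rfl⟩, h0, hf⟩ := hv
  have hf' := hf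
  rw [← form_simpleReflection i, simpleReflection_ofInt] at hf'
  refine ⟨⟨_, ?_, simpleReflection_ofInt i k⟩, by simpa using h0,
    by rwa [form_simpleReflection]⟩
  have hne : ∀ j, j ≠ i → 0 ≤ (k - Pi.single i (cartan.mulVec k i) : Fin 10 → ℤ) j := fun j hj => by
    simp [hj, hk j]
  intro j
  rcases eq_or_ne j i with rfl | hj
  · by_contra! hlt
    exact hf'.not_gt (form_pos_of_one_neg hlt hne)
  · exact hne j hj

theorem weyl_iff {P : DualCartan → Prop} (hP : ∀ i v, P v → P (simpleReflection i v))
    {w : DualCartan ≃ₗ[ℝ] DualCartan} (hw : w ∈ weylGroup) : ∀ v, P v ↔ P (w v) := by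
  induction hw using Subgroup.closure_induction with
  | mem w hw =>
    obtain ⟨i, rfl⟩ := hw
    exact fun v => ⟨hP i v, fun h => by
      simpa [simpleReflection, Module.involutive_reflection _ _] using hP i _ h⟩
  | one => exact fun v => Iff.rfl
  | mul w₁ w₂ _ _ h₁ h₂ => exact fun v => (h₂ v).trans (h₁ (w₂ v))
  | inv w _ h => exact fun v => by simpa using (h (w⁻¹ v)).symm

theorem form_weyl {w : DualCartan ≃ₗ[ℝ] DualCartan} (hw : w ∈ weylGroup) (v : DualCartan) :
    form (w v) (w v) = form v v :=
  (weyl_iff (P := fun u => form u u = form v v)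
    (fun i u hu => (form_simpleReflection i u).trans hu) hw v).1 rfl

/-- Integrality is carried along because the sl₂ argument needs an integral eigenvalue of the
coroot. -/
theorem isRoot_and_integral_weyl {w : DualCartan ≃ₗ[ℝ] DualCartan} (hw : w ∈ weylGroup)
    (v : DualCartan) : (IsRoot v ∧ ∃ k, v = ofInt k) ↔ (IsRoot (w v) ∧ ∃ k, w v = ofInt k) := by
  refine weyl_iff (P := fun u => IsRoot u ∧ ∃ k, u = ofInt k) ?_ hw v
  rintro i _ ⟨hr, k, rfl⟩
  exact ⟨hr.simpleReflection i _ (evalCoroot_ofInt i k), _, simpleReflection_ofInt i k⟩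

theorem IsRealRoot.exists_ofInt {v : DualCartan} (hv : IsRealRoot v) : ∃ k, v = ofInt k := by
  obtain ⟨-, w, hw, i, hi⟩ := hv
  refine (weyl_iff (P := fun u => ∃ k, u = ofInt k) ?_ hw v).2 ⟨_, hi.trans (simpleRoot_eq_ofInt i)⟩
  rintro i _ ⟨k, rfl⟩
  exact ⟨_, simpleReflection_ofInt i k⟩

theorem IsRealRoot.form_self {v : DualCartan} (hv : IsRealRoot v) : form v v = 2 := by
  obtain ⟨-, w, hw, i, hi⟩ := hv
  rw [← form_weyl hw, hi, form_simpleRoot_self]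

theorem IsRealRoot.weyl {v : DualCartan} (hv : IsRealRoot v) {w : DualCartan ≃ₗ[ℝ] DualCartan}
    (hw : w ∈ weylGroup) : IsRealRoot (w v) := by
  refine ⟨((isRoot_and_integral_weyl hw v).1 ⟨hv.1, hv.exists_ofInt⟩).1, ?_⟩
  obtain ⟨u, hu, i, hi⟩ := hv.2
  exact ⟨u * w⁻¹, mul_mem hu (inv_mem hw), i, by simpa using hi⟩

theorem IsRealRoot.exists_reflection {v : DualCartan} (hv : IsRealRoot v) :
    ∃ w ∈ weylGroup, w v = -v := by
  obtain ⟨-, w, hw, i, hi⟩ := hv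
  refine ⟨w⁻¹ * simpleReflection i * w,
    mul_mem (mul_mem (inv_mem hw) (Subgroup.subset_closure ⟨i, rfl⟩)) hw, ?_⟩
  rw [LinearEquiv.mul_apply, LinearEquiv.mul_apply, hi, simpleReflection_simpleRoot, map_neg, ← hi]
  simp

theorem IsRealRoot.neg {v : DualCartan} (hv : IsRealRoot v) : IsRealRoot (-v) := by
  obtain ⟨w, hw, h⟩ := hv.exists_reflection
  exact h ▸ hv.weyl hw

theorem sum_simpleRoot (k : Fin 10 → ℕ) :
    ∑ i, k i • simpleRoot i = ofInt fun i => (k i : ℤ) := by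
  ext j
  simp [simpleRoot, ofInt, Finset.sum_apply, Pi.single_apply]

theorem IsPosRoot.exists_ofInt {v : DualCartan} (hv : IsPosRoot v) :
    ∃ k : Fin 10 → ℤ, (∀ i, 0 ≤ k i) ∧ v = ofInt k := by
  obtain ⟨-, k, rfl⟩ := hv
  exact ⟨_, fun i => Int.natCast_nonneg _, sum_simpleRoot k⟩

theorem IsRealRoot.isPosRealRoot {k : Fin 10 → ℤ} (hv : IsRealRoot (ofInt k)) (hk : ∀ i, 0 ≤ k i) :
    IsPosRealRoot (ofInt k) := by
  refine ⟨hv, hv.1, fun i => (k i).toNat, ?_⟩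
  rw [sum_simpleRoot]
  congr 1
  ext i
  simp [hk i]

theorem IsRealRoot.pos_or_neg {v : DualCartan} (hv : IsRealRoot v) :
    IsPosRealRoot v ∨ IsPosRealRoot (-v) := by
  obtain ⟨k, rfl⟩ := hv.exists_ofInt
  refine (nonneg_or_nonpos_of_form_eq_two hv.form_self).imp hv.isPosRealRoot fun h => ?_
  rw [← ofInt_neg]
  exact IsRealRoot.isPosRealRoot (ofInt_neg k ▸ hv.neg) fun i => by simpa using h i

theorem IsPosImagRoot.imagCone {v : DualCartan} (hv : IsPosImagRoot v) : ImagCone v :=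
  ⟨hv.2.exists_ofInt, hv.1.1.1, hv.1.2⟩

theorem ImagCone.weyl {v : DualCartan} (hv : ImagCone v) {w : DualCartan ≃ₗ[ℝ] DualCartan}
    (hw : w ∈ weylGroup) : ImagCone (w v) :=
  (weyl_iff (fun i _ h => h.simpleReflection i) hw v).1 hv

/-! ### Descent on the height of the subtracted root -/

theorem sum_lt_sum_of_imagCone_sub {k l : Fin 10 → ℤ} (h : ImagCone (ofInt k - ofInt l)) :
    ∑ i, l i < ∑ i, k i := by
  obtain ⟨⟨c, hc, hkl⟩, h0, -⟩ := h
  rw [hkl] at h0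
  rw [← ofInt_sub] at hkl
  rw [← ofInt_injective hkl] at hc h0
  obtain ⟨i, hi⟩ : ∃ i, k i - l i ≠ 0 := by
    by_contra! hz
    exact h0 (by ext i; simp [ofInt, hz i])
  refine Finset.sum_lt_sum (fun i _ => by simpa using hc i) ⟨i, Finset.mem_univ i, ?_⟩
  have := hc i
  simp only [Pi.sub_apply] at this
  omega

theorem exists_sum_of_sub {γ : DualCartan} (hγ : ImagCone γ) (n : ℕ) :
    ∀ w ∈ weylGroup, ∀ (α : DualCartan) (k : Fin 10 → ℤ), IsPosRealRoot α →
      IsPosRealRoot (ofInt k) → (∀ i, 0 ≤ k i) → ∑ i, k i ≤ n → w γ = α - ofInt k →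
      ∃ w ∈ weylGroup, ∃ α' β' : DualCartan,
        IsPosRealRoot α' ∧ IsPosRealRoot β' ∧ w γ = α' + β' := by
  induction n with
  | zero =>
    intro w _ α k _ hβ hk hn _
    -- Height 0 would force `β = 0`, which is not a root.
    refine absurd ?_ hβ.1.1.1
    have := (Finset.sum_eq_zero_iff_of_nonneg fun i _ => hk i).1
      (le_antisymm hn (Finset.sum_nonneg fun i _ => hk i))
    ext i
    simp [ofInt, this i (Finset.mem_univ i)]
  | succ n ih =>
    intro w hw α k hα hβ hk hn hγw
    obtain ⟨s, hs, hsβ⟩ := hβ.1.exists_reflection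
    have hsw : (s * w) γ = s α + ofInt k := by
      rw [LinearEquiv.mul_apply, hγw, map_sub, hsβ, sub_neg_eq_add]
    rcases (hα.1.weyl hs).pos_or_neg with h | h
    · exact ⟨s * w, mul_mem hs hw, s α, ofInt k, h, hβ, hsw⟩
    · obtain ⟨l, hl, hlα⟩ := h.2.exists_ofInt
      rw [hlα] at h
      have hsw' : (s * w) γ = ofInt k - ofInt l := by rw [hsw, ← hlα]; abel
      have hlt := sum_lt_sum_of_imagCone_sub (hsw' ▸ hγ.weyl (mul_mem hs hw))
      exact ih (s * w) (mul_mem hs hw) (ofInt k) l hβ h hl (by push_cast at hn; omega) hsw'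

end E10

theorem mainTheorem6 (γ : E10.DualCartan) (hγ : E10.IsPosImagRoot γ)
    (h : ∃ w ∈ E10.weylGroup, ∃ α β : E10.DualCartan,
      E10.IsPosRealRoot α ∧ E10.IsPosRealRoot β ∧ w γ = α - β) :
    ∃ w ∈ E10.weylGroup, ∃ α' β' : E10.DualCartan,
      E10.IsPosRealRoot α' ∧ E10.IsPosRealRoot β' ∧ w γ = α' + β' := by
  obtain ⟨w, hw, α, β, hα, hβ, hwγ⟩ := h
  obtain ⟨k, hk, rfl⟩ := hβ.2.exists_ofInt
  exact E10.exists_sum_of_sub hγ.imagCone (∑ i, k i).toNat w hw α k hα hβ hk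
    (Int.self_le_toNat _) hwγ
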